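/- Let $(G_n)_{n}$ be a sequence of finite trees, each with at least two vertices, and let $G_n$ be rooted at a vertex $o_n$. For a tree $G=(V,E)$ with root $o$, let $\ell(v)$ be the set of edges of the shortest path from $o$ to $v\in V$ and $|v|:=|\ell(v)|$. For $e\in E$ let $e_+$ be the endpoint of $e$ that is farther from $o$, put $|e|:=|e_+|$, and let $|T_e|$ be the number of vertices of the largest subtree of $G$ that contains $e_+$ and has all its vertices at distance at least $|e_+|$ from $o$. A vertex $x$ is a $\delta$-center of mass of $G$ if there are two subtrees $T,\tilde T$ of $G$ with $V(T)\cap V(\tilde T)=\{x\}$, $V(T)\cup V(\tilde T)=V$, $|V(T)|\ge\delta|V|$ and $|V(\tilde T)|\ge\delta|V|$. The simple random walk $(\eta_t)_{t\ge 0}$ on $G$ is the continuous-time Markov chain that moves along every edge at rate $1$, that is, with generator $(\mathcal Lf)(x)=\sum_{y\sim x}(f(y)-f(x))$. With $\pi$ the uniform distribution on $V$ and $\|\mu-\nu\|_{\mathrm{TV}}=\max_{A\subseteq V}|\mu(A)-\nu(A)|$, its $\varepsilon$-mixing time is $$t_{\mathrm{mix}}(\varepsilon)=\inf\Big\{t\ge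 0:\ \max_{x\in V}\|\mathbb P(\eta_t\in\cdot\mid\eta_0=x)-\pi\|_{\mathrm{TV}}\le\varepsilon\Big\}.$$ The walks on $(G_n)$ exhibit cutoff if $\lim_{n\to\infty} t^n_{\mathrm{mix}}(1-\varepsilon)/t^n_{\mathrm{mix}}(\varepsilon)=1$ for every $\varepsilon\in(0,1)$. **Theorem.** Suppose that there is $\delta>0$, not depending on $n$, such that $o_n$ is a $\delta$-center of mass of $G_n$ for every $n$, and that $$\max_{e\in E(G_n)}|e|\,|T_e|\ \asymp\ \max_{v\in V(G_n)}\ \sum_{e\in\ell(v)}|T_e| ,$$ that is, each side is at most a constant multiple of the other for all sufficiently large $n$. Then the simple random walk on $(G_n)$ does not exhibit cutoff. -/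

import Mathlib

namespace TreeWalk

/-! ### The variable speed simple random walk and its mixing time -/

section Walk

variable {V : Type*} [Fintype V] [DecidableEq V]

/-- Generator of the continuous-time simple random walk in the variable speed model, which
crosses every edge at rate `1`: `(L f) x = ∑_{y ∼ x} (f y - f x)`. As a matrix it is the adjacency
matrix minus the degree matrix. -/
noncomputable def generator (G : SimpleGraph V) [DecidableRel G.Adj] : Matrix V V ℝ :=
  G.adjMatrix ℝ - G.degMatrix ℝ

/-- Transition probabilities `P(η_t = y ∣ η_0 = x)` of the walk: the entries of `exp (t L)`. -/
noncomputable def transition (G : SimpleGraph V) [DecidableRel G.Adj] (t : ℝ) (x y : V) : ℝ :=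
  NormedSpace.exp (t • generator G) x y

/-- Total-variation distance `max_{A ⊆ V} |μ(A) - ν(A)|` of two probability measures on the finite
set `V`, given by their point masses. -/
noncomputable def tvDist (μ ν : V → ℝ) : ℝ :=
  (Finset.univ : Finset (Finset V)).sup' Finset.univ_nonempty
    (fun A => |∑ y ∈ A, μ y - ∑ y ∈ A, ν y|)

/-- Point masses of the uniform distribution on `V`. -/
noncomputable def uniform (V : Type*) [Fintype V] : V → ℝ :=
  fun _ => (Fintype.card V : ℝ)⁻¹

/-- The `ε`-mixing time: the infimum of the times `t ≥ 0` at which, from every starting point, the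
law of the walk is within total-variation distance `ε` of the uniform distribution. -/
noncomputable def mixingTime (G : SimpleGraph V) [DecidableRel G.Adj] (ε : ℝ) : ℝ :=
  sInf {t : ℝ | 0 ≤ t ∧ ∀ x : V, tvDist (transition G t x) (uniform V) ≤ ε}

end Walk

/-- The walks on `(G n)` exhibit cutoff: `t_mix^n(1 - ε) / t_mix^n(ε) → 1` for every
`ε ∈ (0, 1)`. -/
def ExhibitsCutoff {V : ℕ → Type*} [∀ n, Fintype (V n)] [∀ n, DecidableEq (V n)]
    (G : ∀ n, SimpleGraph (V n)) [∀ n, DecidableRel (G n).Adj] : Prop :=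
  ∀ ε : ℝ, 0 < ε → ε < 1 →
    Filter.Tendsto (fun n => mixingTime (G n) (1 - ε) / mixingTime (G n) ε)
      Filter.atTop (nhds 1)

/-! ### Rooted trees; `|v|` is the graph distance `G.dist o v` from the root `o` -/

section Rooted

variable {V : Type*} (G : SimpleGraph V) (o : V)

/-- The endpoint `e₊` of an edge `e` that is farther from the root `o`. -/
noncomputable def upperEnd (e : Sym2 V) : V :=
  if G.dist o (Quot.out e).1 < G.dist o (Quot.out e).2 then (Quot.out e).2 else (Quot.out e).1

/-- `|e| = |e₊|`. -/
noncomputable def edgeHeight (e : Sym2 V) : ℕ :=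
  G.dist o (upperEnd G o e)

/-- `x` is a `δ`-center of mass: two subtrees of `G` that cover all vertices and meet in `x` only
have at least `δ |V|` vertices each. -/
def IsCenterOfMass (δ : ℝ) (x : V) : Prop :=
  ∃ T T' : G.Subgraph, T.coe.IsTree ∧ T'.coe.IsTree ∧
    T.verts ∩ T'.verts = {x} ∧ T.verts ∪ T'.verts = Set.univ ∧
    δ * (Nat.card V : ℝ) ≤ (T.verts.ncard : ℝ) ∧ δ * (Nat.card V : ℝ) ≤ (T'.verts.ncard : ℝ)

variable [Fintype V]

open Classical in
/-- Vertex set of `T_v`, the largest subtree containing `v` all of whose vertices are at distance at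
least `|v|` from the root: the vertices that can be joined to `v` through such vertices. -/
noncomputable def subtree (v : V) : Finset V :=
  Finset.univ.filter
    (fun w => ∃ p : G.Walk v w, ∀ u ∈ p.support, G.dist o v ≤ G.dist o u)

/-- `|T_e| = |V(T_{e₊})|`. -/
noncomputable def edgeSubtreeSize (e : Sym2 V) : ℕ :=
  (subtree G o (upperEnd G o e)).card

open Classical in
/-- `ℓ(v)`: the edges of the shortest path from the root to `v`. -/
noncomputable def pathEdges (v : V) : Finset (Sym2 V) :=
  Finset.univ.filter
    (fun e => ∃ p : G.Walk o v, p.length = G.dist o v ∧ e ∈ p.edges)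

open Classical in
/-- `max_{e ∈ E} |e| |T_e|`. -/
noncomputable def maxEdgeWeight : ℕ :=
  G.edgeFinset.sup (fun e => edgeHeight G o e * edgeSubtreeSize G o e)

/-- `max_{v ∈ V} ∑_{e ∈ ℓ(v)} |T_e|`. -/
noncomputable def maxPathWeight : ℕ :=
  Finset.univ.sup (fun v => ∑ e ∈ pathEdges G o v, edgeSubtreeSize G o e)

end Rooted

end TreeWalk

/-! Cutoff fails because relaxation and mixing happen on the same time scale. Let M be the maximal
path weight, m the maximal edge weight and N the number of vertices.

Upper bound. The sum of the sizes |T_e| along the root path of x is the expected hitting time of o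
from x: the generator maps it to at most -1 off o (`generator_hittingSum_le`), and it is bounded by
M. Return probabilities never drop below 1/N, so after time of order M every P_t(x,o) is at least
1/(2N). By symmetry the same argument, run once more, gives P_t(x,y) ≥ 1/(4N) (`heat_minorization`).
Hence t_mix(3/4) ≤ 4 M log 4.

Lower bound. Let v be the upper end of an edge attaining m. The number of common ancestors of x and
v has Dirichlet energy at most |v|. It equals |v|+1 on T_v and, since o is a center of mass, 1 on at
least δN vertices. The Rayleigh quotient of its centering gives a mean-zero eigenvector with rate at
most (1+δ)/(δm) (`exists_eigenvector_le_inv_maxEdgeWeight`). It keeps the walk from mixing: e^{-λt}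
≤ 2ε at any ε-mixed time t, so t_mix(ε) exceeds any prescribed multiple of m once ε is small.

As M ≤ Km eventually, a small ε makes t_mix(1-ε)/t_mix(ε) at most 1/2. -/

namespace TreeWalk

open Matrix

/-! ### The heat semigroup: symmetry, conservation of mass, return probabilities. -/

section Semigroup

variable {V : Type*} [Fintype V] [DecidableEq V] (G : SimpleGraph V) [DecidableRel G.Adj]

/-- The heat semigroup `exp (t L)` of the walk. -/
noncomputable def heat (t : ℝ) : Matrix V V ℝ :=
  NormedSpace.exp (t • generator G)

lemma generator_eq_neg_lapMatrix : generator G = -G.lapMatrix ℝ := by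
  simp [generator, SimpleGraph.lapMatrix]

lemma generator_mulVec_apply (f : V → ℝ) (x : V) :
    (generator G *ᵥ f) x = ∑ y ∈ G.neighborFinset x, (f y - f x) := by
  rw [generator_eq_neg_lapMatrix, neg_mulVec, Pi.neg_apply, SimpleGraph.lapMatrix_mulVec_apply,
    Finset.sum_sub_distrib]
  simp

lemma generator_isSymm : (generator G).IsSymm := by
  rw [generator_eq_neg_lapMatrix]
  exact (G.isSymm_lapMatrix ℝ).neg

lemma heat_zero : heat G 0 = 1 := by
  simp [heat]

lemma heat_add (s t : ℝ) : heat G (s + t) = heat G s * heat G t := by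
  rw [heat, add_smul]
  exact Matrix.exp_add_of_commute _ _ (((Commute.refl (generator G)).smul_left s).smul_right t)

lemma heat_isSymm (t : ℝ) : (heat G t).IsSymm :=
  ((generator_isSymm G).smul t).exp

lemma heat_comm (t : ℝ) (x y : V) : heat G t x y = heat G t y x :=
  (heat_isSymm G t).apply y x

lemma hasDerivAt_heat_apply (t : ℝ) (x y : V) :
    HasDerivAt (fun s => heat G s x y) ((generator G * heat G t) x y) t ∧
      HasDerivAt (fun s => heat G s x y) ((heat G t * generator G) x y) t := by
  let _ : NormedRing (Matrix V V ℝ) := Matrix.linftyOpNormedRing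
  let _ : NormedAlgebra ℝ (Matrix V V ℝ) := Matrix.linftyOpNormedAlgebra
  have key : ∀ A : Matrix V V ℝ, HasDerivAt (fun s : ℝ => heat G s) A t →
      HasDerivAt (fun s => heat G s x y) (A x y) t := by
    intro A hA
    let l : Matrix V V ℝ →L[ℝ] ℝ :=
      LinearMap.toContinuousLinearMap (Matrix.entryLinearMap ℝ ℝ x y)
    exact l.hasFDerivAt.comp_hasDerivAt t hA
  exact ⟨key _ (hasDerivAt_exp_smul_const' (𝕂 := ℝ) (generator G) t),
    key _ (hasDerivAt_exp_smul_const (𝕂 := ℝ) (generator G) t)⟩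

lemma hasDerivAt_heat_mulVec (f : V → ℝ) (t : ℝ) (x : V) :
    HasDerivAt (fun s => (heat G s *ᵥ f) x) ((generator G *ᵥ (heat G t *ᵥ f)) x) t := by
  rw [mulVec_mulVec]
  exact HasDerivAt.fun_sum fun y _ => (hasDerivAt_heat_apply G t x y).1.mul_const (f y)

lemma hasDerivAt_heat_mulVec' (f : V → ℝ) (t : ℝ) (x : V) :
    HasDerivAt (fun s => (heat G s *ᵥ f) x) ((heat G t *ᵥ (generator G *ᵥ f)) x) t := by
  rw [mulVec_mulVec]
  exact HasDerivAt.fun_sum fun y _ => (hasDerivAt_heat_apply G t x y).2.mul_const (f y)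

/-- The semigroup acts on an eigenvector of the generator by an exponential. -/
lemma heat_mulVec_of_eigenvector {f : V → ℝ} {μ : ℝ} (hf : generator G *ᵥ f = μ • f) (t : ℝ) :
    heat G t *ᵥ f = Real.exp (μ * t) • f := by
  ext x
  have hd : ∀ s : ℝ, HasDerivAt (fun s => Real.exp (-μ * s) * (heat G s *ᵥ f) x) 0 s := by
    intro s
    have h1 := hasDerivAt_heat_mulVec' G f s x
    rw [hf, mulVec_smul] at h1
    have h2 : HasDerivAt (fun s : ℝ => Real.exp (-μ * s)) (Real.exp (-μ * s) * -μ) s := by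
      simpa using ((hasDerivAt_id s).const_mul (-μ)).exp
    refine (h2.fun_mul h1).congr_deriv ?_
    simp only [Pi.smul_apply, smul_eq_mul]
    ring
  have hc := is_const_of_deriv_eq_zero (fun s => (hd s).differentiableAt)
    (fun s => (hd s).deriv) t 0
  simp only [heat_zero, one_mulVec, mul_zero, Real.exp_zero, one_mul] at hc
  rw [Pi.smul_apply, smul_eq_mul, ← hc, ← mul_assoc, ← Real.exp_add]
  simp

lemma heat_mulVec_one (t : ℝ) : heat G t *ᵥ (1 : V → ℝ) = 1 := by
  have h : generator G *ᵥ (1 : V → ℝ) = (0 : ℝ) • 1 := by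
    ext x
    simp [generator_mulVec_apply]
  simpa using heat_mulVec_of_eigenvector G h t

lemma sum_heat (t : ℝ) (x : V) : ∑ y, heat G t x y = 1 := by
  simpa [mulVec, dotProduct] using congrFun (heat_mulVec_one G t) x

lemma sum_heat_mulVec (t : ℝ) (f : V → ℝ) : ∑ x, (heat G t *ᵥ f) x = ∑ x, f x := by
  simp only [mulVec, dotProduct]
  rw [Finset.sum_comm]
  refine Finset.sum_congr rfl fun y _ => ?_
  rw [← Finset.sum_mul]
  simp_rw [fun x => heat_comm G t x y]
  rw [sum_heat, one_mul]

/-- Return probabilities are bounded below by the stationary mass. -/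
lemma inv_card_le_heat_self [Nonempty V] (t : ℝ) (x : V) :
    (Fintype.card V : ℝ)⁻¹ ≤ heat G t x x := by
  -- Symmetry turns Chapman–Kolmogorov into a sum of squares of a vector of total mass 1;
  -- Cauchy–Schwarz does the rest.
  have h1 : heat G t x x = ∑ y, heat G (t / 2) x y ^ 2 := by
    rw [← add_halves t, heat_add, mul_apply, add_halves]
    exact Finset.sum_congr rfl fun y _ => by rw [heat_comm G _ y x, sq]
  have h2 := sq_sum_le_card_mul_sum_sq (s := Finset.univ) (f := fun y => heat G (t / 2) x y)
  rw [sum_heat, ← h1, one_pow, Finset.card_univ] at h2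
  have hN : (0 : ℝ) < Fintype.card V := by exact_mod_cast Fintype.card_pos
  rwa [inv_le_iff_one_le_mul₀' hN]

end Semigroup

/-! ### Maximum principle, barriers and the uniform minorization. -/

section MaximumPrinciple

variable {V : Type*} [Fintype V] [DecidableEq V] (G : SimpleGraph V) [DecidableRel G.Adj]

/-- Strict form of the maximum principle for supersolutions of the heat equation off `S`. -/
lemma pos_of_strict_supersolution {S : Set V} {z z' : ℝ → V → ℝ}
    (hd : ∀ t x, HasDerivAt (fun s => z s x) (z' t x) t)
    (h0 : ∀ x, 0 < z 0 x) (hS : ∀ t, 0 ≤ t → ∀ x ∈ S, 0 < z t x)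
    (hz : ∀ t, 0 ≤ t → ∀ x ∉ S, (generator G *ᵥ z t) x < z' t x)
    {t : ℝ} (ht : 0 ≤ t) (x : V) : 0 < z t x := by
  by_contra hneg
  push Not at hneg
  have hcont : ∀ y, Continuous fun s => z s y := fun y =>
    continuous_iff_continuousAt.2 fun s => (hd s y).continuousAt
  -- At the first time s of failure, z vanishes at a spatial minimum y outside S: there the
  -- generator is nonnegative while the left derivative in time is nonpositive, against strictness.
  set B : Set ℝ := {s | 0 ≤ s ∧ ∃ y, z s y ≤ 0} with hB
  have hBclosed : IsClosed B := by
    have : B = Set.Ici 0 ∩ ⋃ y, {s | z s y ≤ 0} := by ext s; simp [hB]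
    rw [this]
    exact isClosed_Ici.inter (isClosed_iUnion_of_finite fun y =>
      isClosed_le (hcont y) continuous_const)
  have hBbdd : BddBelow B := ⟨0, fun s hs => hs.1⟩
  obtain ⟨hs0, y, hy⟩ : sInf B ∈ B := hBclosed.csInf_mem ⟨t, ht, x, hneg⟩ hBbdd
  set s := sInf B with hs
  have hlt : ∀ r, 0 ≤ r → r < s → ∀ w, 0 < z r w := by
    intro r hr hrs w
    by_contra hw
    exact absurd (csInf_le hBbdd (show r ∈ B from ⟨hr, w, not_lt.1 hw⟩)) (not_le.2 hrs)
  have hspos : 0 < s := lt_of_le_of_ne hs0 fun h => by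
    rw [← h] at hy
    exact absurd (h0 y) (not_lt.2 hy)
  have hev : ∀ᶠ r in nhdsWithin s (Set.Iio s), r ∈ Set.Ioo 0 s := Ioo_mem_nhdsLT hspos
  have hge : ∀ w, 0 ≤ z s w := fun w =>
    ge_of_tendsto (((hcont w).tendsto s).mono_left nhdsWithin_le_nhds)
      (hev.mono fun r hr => (hlt r hr.1.le hr.2 w).le)
  have hzy : z s y = 0 := le_antisymm hy (hge y)
  have hyS : y ∉ S := fun h => absurd (hS s hs0 y h) (not_lt.2 hy)
  have hL : 0 ≤ (generator G *ᵥ z s) y := by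
    rw [generator_mulVec_apply]
    exact Finset.sum_nonneg fun w _ => by rw [hzy, sub_zero]; exact hge w
  have hder : z' s y ≤ 0 := by
    have h1 := hasDerivWithinAt_iff_tendsto_slope' (s := Set.Iio s) (by simp) |>.1
      (hd s y).hasDerivWithinAt
    refine le_of_tendsto h1 (hev.mono fun r hr => ?_)
    rw [slope_def_field, hzy, sub_zero]
    exact div_nonpos_of_nonneg_of_nonpos (hlt r hr.1.le hr.2 y).le (by linarith [hr.2])
  linarith [hz s hs0 y hyS]

/-- Maximum principle: a supersolution of the heat equation off `S` that is nonnegative on `S` and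
at time `0` stays nonnegative. -/
lemma nonneg_of_supersolution {S : Set V} {z z' : ℝ → V → ℝ}
    (hd : ∀ t x, HasDerivAt (fun s => z s x) (z' t x) t)
    (h0 : ∀ x, 0 ≤ z 0 x) (hS : ∀ t, 0 ≤ t → ∀ x ∈ S, 0 ≤ z t x)
    (hz : ∀ t, 0 ≤ t → ∀ x ∉ S, (generator G *ᵥ z t) x ≤ z' t x)
    {t : ℝ} (ht : 0 ≤ t) (x : V) : 0 ≤ z t x := by
  -- Adding η(1+t) makes all inequalities strict: it is constant in space, so invisible to the
  -- generator, and has time derivative η.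
  have key : ∀ η : ℝ, 0 < η → 0 < z t x + η * (1 + t) := by
    intro η hη
    refine pos_of_strict_supersolution G (S := S) (z := fun s y => z s y + η * (1 + s))
      (z' := fun s y => z' s y + η) (fun s y => ?_) (fun y => ?_) (fun s hs y hy => ?_)
      (fun s hs y hy => ?_) ht x
    · simpa using (hd s y).fun_add (((hasDerivAt_id s).const_add 1).const_mul η)
    · have := h0 y
      simp only [add_zero, mul_one]
      linarith
    · have := hS s hs y hy
      positivity
    · have h1 := hz s hs y hy
      rw [generator_mulVec_apply] at h1 ⊢
      simp only [add_sub_add_right_eq_sub]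
      linarith
  refine le_of_forall_pos_lt_add fun e he => ?_
  have h1 : (0 : ℝ) < 1 + t := by linarith
  have := key (e / (1 + t)) (by positivity)
  rwa [div_mul_cancel₀ _ h1.ne'] at this

lemma heat_nonneg {t : ℝ} (ht : 0 ≤ t) (x y : V) : 0 ≤ heat G t x y := by
  have h := nonneg_of_supersolution G (S := ∅) (z := fun s => heat G s *ᵥ Pi.single y 1)
    (z' := fun s => generator G *ᵥ (heat G s *ᵥ Pi.single y 1))
    (fun s w => hasDerivAt_heat_mulVec G _ s w)
    (fun w => by rw [heat_zero, one_mulVec, Pi.single_apply]; split_ifs <;> simp)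
    (by simp) (fun _ _ _ _ => le_rfl) ht x
  simpa using h

/-- A nonnegative solution of the heat equation that stays above `c` at `o` fills up to `c`
everywhere on the time scale given by a function `g` with `L g ≤ -1` off `o`. -/
lemma le_of_solution_of_barrier {o : V} {g : V → ℝ} {M : ℝ} (hM : 0 < M)
    (hg0 : ∀ x, 0 ≤ g x) (hgM : ∀ x, g x ≤ M) (hg : ∀ x, x ≠ o → (generator G *ᵥ g) x ≤ -1)
    {c : ℝ} (hc : 0 ≤ c) {u : ℝ → V → ℝ}
    (hu : ∀ t x, HasDerivAt (fun s => u s x) ((generator G *ᵥ u t) x) t)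
    (hu0 : ∀ x, 0 ≤ u 0 x) (huo : ∀ t, 0 ≤ t → c ≤ u t o) {t : ℝ} (ht : 0 ≤ t) (x : V) :
    c * (1 - 2 * Real.exp (-(t / (2 * M)))) ≤ u t x := by
  have hexp : ∀ s : ℝ, HasDerivAt (fun s => Real.exp (-(s / (2 * M))))
      (-(Real.exp (-(s / (2 * M))) / (2 * M))) s := by
    intro s
    refine (((hasDerivAt_id' s).div_const (2 * M)).fun_neg.exp).congr_deriv ?_
    ring
  -- The comparison function is at most 0 at time 0 and at most c at o. Off o it is a subsolution:
  -- as 1 + g/M ≤ 2, decay at rate 1/(2M) is slow enough to be paid for by L g ≤ -1.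
  have key := nonneg_of_supersolution G (S := {o})
    (z := fun s y => u s y - c * (1 - Real.exp (-(s / (2 * M))) * (1 + g y / M)))
    (z' := fun s y => (generator G *ᵥ u s) y -
      c * (0 - -(Real.exp (-(s / (2 * M))) / (2 * M)) * (1 + g y / M)))
    (fun s y => (hu s y).sub ((((hasDerivAt_const s (1 : ℝ)).sub
      ((hexp s).mul_const (1 + g y / M)))).const_mul c)) ?_ ?_ ?_ ht x
  · have h1 : 1 + g x / M ≤ 2 := by
      have := (div_le_one hM).2 (hgM x)
      linarith
    have h2 := mul_le_mul_of_nonneg_left h1 (Real.exp_pos (-(t / (2 * M)))).le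
    have h3 := mul_le_mul_of_nonneg_left h2 hc
    linarith
  · intro y
    have h1 : 0 ≤ c * (g y / M) := mul_nonneg hc (div_nonneg (hg0 y) hM.le)
    have h2 := hu0 y
    simp only [zero_div, neg_zero, Real.exp_zero, one_mul]
    linarith
  · rintro s hs y rfl
    have h1 : 0 ≤ c * (Real.exp (-(s / (2 * M))) * (1 + g y / M)) :=
      mul_nonneg hc (mul_nonneg (Real.exp_pos _).le
        (add_nonneg zero_le_one (div_nonneg (hg0 y) hM.le)))
    have h2 := huo s hs
    linarith
  · intro s hs y hy
    set E := Real.exp (-(s / (2 * M))) with hE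
    have hEpos : 0 < E := Real.exp_pos _
    have hL : (generator G *ᵥ fun y => u s y - c * (1 - E * (1 + g y / M))) y
        = (generator G *ᵥ u s) y + c * E / M * (generator G *ᵥ g) y := by
      simp only [generator_mulVec_apply]
      rw [Finset.mul_sum, ← Finset.sum_add_distrib]
      exact Finset.sum_congr rfl fun w _ => by ring
    rw [hL]
    have h1 : c * E / M * (generator G *ᵥ g) y ≤ c * E / M * (-1) :=
      mul_le_mul_of_nonneg_left (hg y hy) (by positivity)
    have h2 : c * E / (2 * M) * (1 + g y / M) ≤ c * E / (2 * M) * 2 := by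
      refine mul_le_mul_of_nonneg_left ?_ (by positivity)
      have := (div_le_one hM).2 (hgM y)
      linarith
    have h3 : c * E / (2 * M) * 2 = c * E / M := by field_simp
    have h4 : c * (0 - -(E / (2 * M)) * (1 + g y / M)) = c * E / (2 * M) * (1 + g y / M) := by
      ring
    rw [h4]
    linarith

/-- Minorization of the transition probabilities by the uniform distribution. -/
lemma heat_minorization [Nonempty V] {o : V} {g : V → ℝ} {M : ℝ} (hM : 0 < M)
    (hg0 : ∀ x, 0 ≤ g x) (hgM : ∀ x, g x ≤ M) (hg : ∀ x, x ≠ o → (generator G *ᵥ g) x ≤ -1)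
    (x y : V) :
    (4 * (Fintype.card V : ℝ))⁻¹ ≤ heat G (4 * M * Real.log 4) x y := by
  have hN : (0 : ℝ) < Fintype.card V := by exact_mod_cast Fintype.card_pos
  have hlog : 0 ≤ Real.log 4 := Real.log_nonneg (by norm_num)
  -- Chosen so that the factor 1 - 2 exp(-T/(2M)) is exactly 1/2; each of the two stages takes time
  -- T and costs one such factor.
  set T := 2 * M * Real.log 4 with hT
  have hT0 : 0 ≤ T := by positivity
  have hexpT : Real.exp (-(T / (2 * M))) = 1 / 4 := by
    rw [hT, mul_div_cancel_left₀ _ (by positivity), Real.exp_neg, Real.exp_log (by norm_num)]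
    norm_num
  have hsol : ∀ (f : V → ℝ) (a t : ℝ) (w : V), HasDerivAt (fun s => (heat G (a + s) *ᵥ f) w)
      ((generator G *ᵥ (heat G (a + t) *ᵥ f)) w) t := by
    intro f a t w
    simpa using (hasDerivAt_heat_mulVec G f (a + t) w).comp_const_add a t
  have hto : ∀ t, T ≤ t → ∀ w, (Fintype.card V : ℝ)⁻¹ * (1 / 2) ≤ heat G t w o := by
    intro t ht w
    have h := le_of_solution_of_barrier G hM hg0 hgM hg (c := (Fintype.card V : ℝ)⁻¹)
      (by positivity) (u := fun s => heat G (0 + s) *ᵥ Pi.single o 1) (hsol _ 0)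
      (fun w => by simpa using heat_nonneg G le_rfl w o)
      (fun s _ => by simpa using inv_card_le_heat_self G s o) (hT0.trans ht) w
    have hle : Real.exp (-(t / (2 * M))) ≤ 1 / 4 := by
      rw [← hexpT]
      gcongr
    simp only [zero_add, mulVec_single_one, col_apply] at h
    refine le_trans (mul_le_mul_of_nonneg_left ?_ (by positivity)) h
    linarith
  -- Second stage: from time T on, P(o,y) = P(y,o) stays above 1/(2N), which now serves as the
  -- boundary value at o.
  have h := le_of_solution_of_barrier G hM hg0 hgM hg (c := (Fintype.card V : ℝ)⁻¹ * (1 / 2))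
    (by positivity) (u := fun s => heat G (T + s) *ᵥ Pi.single y 1) (hsol _ T)
    (fun w => by simpa using heat_nonneg G hT0 w y)
    (fun s hs => by
      have := hto (T + s) (by linarith) y
      rw [heat_comm] at this
      simpa using this) hT0 x
  rw [hexpT] at h
  simp only [mulVec_single_one, col_apply] at h
  rw [show 4 * M * Real.log 4 = T + T by rw [hT]; ring]
  refine le_trans (le_of_eq ?_) h
  field_simp
  norm_num

end MaximumPrinciple

/-! ### Root paths, descendants, and the two functions on the tree. -/

section Ancestors

lemma upperEnd_of_dist_lt {V : Type*} {G : SimpleGraph V} {o x y : V} (h : G.dist o x < G.dist o y) :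
    upperEnd G o s(x, y) = y := by
  have hq : s((Quot.out s(x, y)).1, (Quot.out s(x, y)).2) = s(x, y) := Quot.out_eq _
  unfold upperEnd
  rcases Sym2.eq_iff.1 hq with ⟨h1, h2⟩ | ⟨h1, h2⟩
  · rw [h1, h2, if_pos h]
  · rw [h1, h2, if_neg (not_lt.2 h.le)]

variable {V : Type*} {G : SimpleGraph V} (hG : G.IsTree) (o : V)

/-- The path from the root `o` to `x`. -/
noncomputable def rootPath (x : V) : G.Walk o x :=
  (hG.existsUnique_path o x).choose

lemma rootPath_isPath (x : V) : (rootPath hG o x).IsPath :=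
  (hG.existsUnique_path o x).choose_spec.1

variable {o} in
lemma eq_rootPath {x : V} {p : G.Walk o x} (hp : p.IsPath) : p = rootPath hG o x :=
  (hG.existsUnique_path o x).choose_spec.2 p hp

lemma length_rootPath (x : V) : (rootPath hG o x).length = G.dist o x := by
  obtain ⟨p, hp, hl⟩ := (hG.connected o x).exists_path_of_dist
  rw [← eq_rootPath hG hp, hl]

lemma dist_getVert_rootPath {x : V} {i : ℕ} (hi : i ≤ (rootPath hG o x).length) :
    G.dist o ((rootPath hG o x).getVert i) = i := by
  have h := (rootPath_isPath hG o x).take i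
  rw [← length_rootPath hG, ← eq_rootPath hG h, SimpleGraph.Walk.take_length]
  exact min_eq_left hi

lemma exists_parent (hG : G.IsTree) {o x : V} (hx : x ≠ o) :
    ∃ y, G.Adj x y ∧ G.dist o x = G.dist o y + 1 := by
  have hpos : G.dist o x ≠ 0 := fun h => hx (((hG.connected o x).dist_eq_zero_iff).1 h).symm
  obtain ⟨k, hk⟩ := Nat.exists_eq_succ_of_ne_zero hpos
  have hlen := length_rootPath hG o x
  have hadj := (rootPath hG o x).adj_getVert_succ (i := k) (by omega)
  have h1 : (rootPath hG o x).getVert (k + 1) = x := by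
    rw [← Nat.succ_eq_add_one, ← hk, ← hlen, SimpleGraph.Walk.getVert_length]
  have hdk : G.dist o ((rootPath hG o x).getVert k) = k := dist_getVert_rootPath hG o (by omega)
  rw [h1] at hadj
  exact ⟨_, hadj.symm, by omega⟩

variable [DecidableEq V]

/-- The vertices on the path from the root to `x`, both ends included. -/
noncomputable def ancestors (x : V) : Finset V :=
  (rootPath hG o x).support.toFinset

lemma mem_ancestors {x u : V} : u ∈ ancestors hG o x ↔ u ∈ (rootPath hG o x).support :=
  List.mem_toFinset

lemma self_mem_ancestors (x : V) : x ∈ ancestors hG o x :=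
  (mem_ancestors hG o).2 (rootPath hG o x).end_mem_support

lemma root_mem_ancestors (x : V) : o ∈ ancestors hG o x :=
  (mem_ancestors hG o).2 (rootPath hG o x).start_mem_support

lemma card_ancestors (x : V) : (ancestors hG o x).card = G.dist o x + 1 := by
  rw [ancestors, List.toFinset_card_of_nodup (rootPath_isPath hG o x).support_nodup,
    SimpleGraph.Walk.length_support, length_rootPath]

/-- In an acyclic graph, one of two root paths with adjacent ends extends the other; the distances
decide which. -/
lemma rootPath_eq_concat {x y : V} (hxy : G.Adj x y) (hd : G.dist o y = G.dist o x + 1) :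
    rootPath hG o y = (rootPath hG o x).concat hxy := by
  refine hG.isAcyclic.path_concat (rootPath_isPath hG o x) (rootPath_isPath hG o y) hxy ?_
  by_contra hx
  have hy := hG.isAcyclic.mem_support_of_ne_mem_support_of_adj_of_isPath
    (rootPath_isPath hG o x) (rootPath_isPath hG o y) hxy hx
  have h := congrArg SimpleGraph.Walk.length (hG.isAcyclic.path_concat
    (rootPath_isPath hG o y) (rootPath_isPath hG o x) hxy.symm hy)
  rw [SimpleGraph.Walk.length_concat, length_rootPath, length_rootPath] at h
  omega

lemma ancestors_of_adj {x y : V} (hxy : G.Adj x y) (hd : G.dist o y = G.dist o x + 1) :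
    ancestors hG o y = insert y (ancestors hG o x) := by
  rw [ancestors, rootPath_eq_concat hG o hxy hd, SimpleGraph.Walk.support_concat]
  ext u
  simp [mem_ancestors]

variable {o}

lemma rootPath_takeUntil {x u : V} (hu : u ∈ (rootPath hG o x).support) :
    (rootPath hG o x).takeUntil u hu = rootPath hG o u :=
  eq_rootPath hG ((rootPath_isPath hG o x).takeUntil hu)

lemma ancestors_subset {x u : V} (hu : u ∈ ancestors hG o x) :
    ancestors hG o u ⊆ ancestors hG o x := by
  rw [mem_ancestors] at hu
  intro w hw
  rw [mem_ancestors, ← rootPath_takeUntil hG hu] at hw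
  exact (mem_ancestors hG o).2 ((rootPath hG o x).support_takeUntil_subset_support hu hw)

lemma dist_le_of_mem_ancestors {x u : V} (hu : u ∈ ancestors hG o x) :
    G.dist o u ≤ G.dist o x := by
  have h := Finset.card_le_card (ancestors_subset hG hu)
  rw [card_ancestors, card_ancestors] at h
  omega

lemma getVert_dist_of_mem_ancestors {x u : V} (hu : u ∈ ancestors hG o x) :
    (rootPath hG o x).getVert (G.dist o u) = u := by
  rw [mem_ancestors] at hu
  rw [← length_rootPath hG o u, ← rootPath_takeUntil hG hu]
  exact (rootPath hG o x).getVert_length_takeUntil hu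

lemma eq_of_mem_ancestors_of_dist_eq {x u w : V} (hu : u ∈ ancestors hG o x)
    (hw : w ∈ ancestors hG o x) (h : G.dist o u = G.dist o w) : u = w := by
  rw [← getVert_dist_of_mem_ancestors hG hu, h, getVert_dist_of_mem_ancestors hG hw]

variable (o) in
lemma not_mem_ancestors_of_adj {x y : V} (hd : G.dist o y = G.dist o x + 1) :
    y ∉ ancestors hG o x := fun h => by
  have := dist_le_of_mem_ancestors hG h
  omega

/-- A connected subgraph through the root contains the ancestors of its vertices. -/
lemma ancestors_subset_verts {T : G.Subgraph} (hT : T.coe.IsTree) (ho : o ∈ T.verts) {x : V}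
    (hx : x ∈ T.verts) : ∀ u ∈ ancestors hG o x, u ∈ T.verts := by
  intro u hu
  obtain ⟨p, hp, -⟩ := hT.existsUnique_path ⟨o, ho⟩ ⟨x, hx⟩
  have h : p.map T.hom = rootPath hG o x :=
    eq_rootPath hG (hp.map SimpleGraph.Subgraph.hom_injective)
  have hmem : u ∈ p.support.map T.hom := by
    rw [mem_ancestors, ← h] at hu
    exact (p.support_map T.hom) ▸ hu
  obtain ⟨w, -, rfl⟩ := List.mem_map.1 hmem
  exact w.2

/-- The number of edges shared by the paths from the root to `x` and to `v`, plus one. -/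
noncomputable def commonAncestors (v x : V) : ℝ :=
  ((ancestors hG o x ∩ ancestors hG o v).card : ℝ)

/-- A step away from the root adds only y to the ancestors, so the function changes only across
edges of the path to v. -/
lemma commonAncestors_of_adj {v x y : V} (hxy : G.Adj x y) (hd : G.dist o y = G.dist o x + 1) :
    commonAncestors hG (o := o) v y - commonAncestors hG (o := o) v x =
      if y ∈ ancestors hG o v then 1 else 0 := by
  have hn := not_mem_ancestors_of_adj hG o hd
  rw [commonAncestors, commonAncestors, ancestors_of_adj hG o hxy hd]
  split_ifs with hy
  · rw [Finset.insert_inter_of_mem hy, Finset.card_insert_of_notMem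
      fun h => hn (Finset.mem_inter.1 h).1]
    push_cast
    ring
  · rw [Finset.insert_inter_of_notMem hy, sub_self]

variable [Fintype V]

/-- The vertex set of `T_v` consists of the descendants of `v`. -/
lemma mem_subtree_iff {v x : V} : x ∈ subtree G o v ↔ v ∈ ancestors hG o x := by
  simp only [subtree, Finset.mem_filter, Finset.mem_univ, true_and]
  constructor
  · rintro ⟨p, hp⟩
    -- A walk that stays at height at least |v| cannot leave the descendants of v: a downward step
    -- removes only its starting point from the ancestors, and from v itself it would go too low.
    have key : ∀ {a b : V} (q : G.Walk a b), (∀ u ∈ q.support, G.dist o v ≤ G.dist o u) →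
        v ∈ ancestors hG o a → v ∈ ancestors hG o b := by
      intro a b q
      induction q with
      | nil => exact fun _ h => h
      | @cons a b c hab q ih =>
        intro hq ha
        refine ih (fun u hu => hq u (by simp [hu])) ?_
        rcases hG.dist_eq_dist_add_one_of_adj o hab with hd | hd
        · rw [ancestors_of_adj hG o hab.symm hd, Finset.mem_insert] at ha
          rcases ha with rfl | ha
          · have := hq b (by simp)
            omega
          · exact ha
        · rw [ancestors_of_adj hG o hab hd]
          exact Finset.mem_insert_of_mem ha
    exact key p hp (self_mem_ancestors hG o v)
  · intro hv
    have hv' := (mem_ancestors hG o).1 hv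
    refine ⟨(rootPath hG o x).dropUntil v hv', fun u hu => ?_⟩
    obtain ⟨i, rfl, hi⟩ := SimpleGraph.Walk.mem_support_iff_exists_getVert.1 hu
    have hl : ((rootPath hG o x).takeUntil v hv').length = G.dist o v := by
      rw [rootPath_takeUntil, length_rootPath]
    have hadd : ((rootPath hG o x).takeUntil v hv').length +
        ((rootPath hG o x).dropUntil v hv').length = (rootPath hG o x).length := by
      rw [← SimpleGraph.Walk.length_append, SimpleGraph.Walk.take_spec]
    have hget : ((rootPath hG o x).dropUntil v hv').getVert i =
        (rootPath hG o x).getVert (G.dist o v + i) := by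
      conv_rhs => rw [← SimpleGraph.Walk.take_spec (rootPath hG o x) hv']
      rw [SimpleGraph.Walk.getVert_append, hl]
      simp
    rw [hget, dist_getVert_rootPath hG o (by omega)]
    omega

/-- The expected hitting time of the root from `x`, as the sum of subtree sizes along the path. -/
noncomputable def hittingSum (x : V) : ℝ :=
  ∑ u ∈ (ancestors hG o x).erase o, ((subtree G o u).card : ℝ)

lemma hittingSum_nonneg (x : V) : 0 ≤ hittingSum hG (o := o) x :=
  Finset.sum_nonneg fun _ _ => Nat.cast_nonneg _

lemma hittingSum_le (x : V) : hittingSum hG (o := o) x ≤ maxPathWeight G o := by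
  -- Each non-root ancestor is the upper end of the path edge just below it. Only an upper bound is
  -- needed, so inclusion in the image suffices, without injectivity.
  have hsub : (ancestors hG o x).erase o ⊆ (pathEdges G o x).image (upperEnd G o) := by
    intro u hu
    obtain ⟨huo, hu⟩ := Finset.mem_erase.1 hu
    have hpos : G.dist o u ≠ 0 := fun h =>
      huo (((hG.connected o u).dist_eq_zero_iff).1 h).symm
    obtain ⟨k, hk⟩ := Nat.exists_eq_succ_of_ne_zero hpos
    have hle := dist_le_of_mem_ancestors hG hu
    have hlen := length_rootPath hG o x
    have hget := getVert_dist_of_mem_ancestors hG hu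
    rw [hk] at hget
    have hdk : G.dist o ((rootPath hG o x).getVert k) = k :=
      dist_getVert_rootPath hG o (by omega)
    refine Finset.mem_image.2 ⟨s((rootPath hG o x).getVert k, u), ?_, ?_⟩
    · simp only [pathEdges, Finset.mem_filter, Finset.mem_univ, true_and]
      refine ⟨rootPath hG o x, hlen, ?_⟩
      rw [← hget]
      exact (SimpleGraph.Walk.mk_mem_edges_iff_exists _).2 ⟨k, by omega, rfl⟩
    · exact upperEnd_of_dist_lt (by omega)
  have h : ∑ u ∈ (ancestors hG o x).erase o, (subtree G o u).card ≤
      ∑ e ∈ pathEdges G o x, edgeSubtreeSize G o e :=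
    (Finset.sum_le_sum_of_subset hsub).trans
      (Finset.sum_image_le_of_nonneg fun _ _ => Nat.zero_le _)
  have h2 : ∑ e ∈ pathEdges G o x, edgeSubtreeSize G o e ≤ maxPathWeight G o :=
    Finset.le_sup (f := fun v => ∑ e ∈ pathEdges G o v, edgeSubtreeSize G o e)
      (Finset.mem_univ x)
  rw [hittingSum]
  exact_mod_cast h.trans h2

lemma hittingSum_of_adj {x y : V} (hxy : G.Adj x y) (hd : G.dist o y = G.dist o x + 1) :
    hittingSum hG (o := o) y = hittingSum hG (o := o) x + (subtree G o y).card := by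
  have hyo : y ≠ o := by
    rintro rfl
    simp at hd
  rw [hittingSum, hittingSum, ancestors_of_adj hG o hxy hd, Finset.erase_insert_of_ne hyo,
    Finset.sum_insert fun h => not_mem_ancestors_of_adj hG o hd (Finset.mem_of_mem_erase h),
    add_comm]

/-- The step to the parent contributes -|T_x| and the step to a child c contributes |T_c|. The
subtrees of the children are disjoint and miss x inside T_x, so the total is at most -1. -/
lemma generator_hittingSum_le [DecidableRel G.Adj] {x : V} (hx : x ≠ o) :
    (generator G *ᵥ hittingSum hG (o := o)) x ≤ -1 := by
  rw [generator_mulVec_apply]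
  obtain ⟨y, hxy, hd⟩ := exists_parent hG hx
  have hy : y ∈ G.neighborFinset x := by simpa using hxy
  have hchild : ∀ c ∈ (G.neighborFinset x).erase y, G.Adj x c ∧ G.dist o c = G.dist o x + 1 := by
    intro c hc
    obtain ⟨hcy, hc⟩ := Finset.mem_erase.1 hc
    have hxc : G.Adj x c := by simpa using hc
    refine ⟨hxc, (hG.dist_eq_dist_add_one_of_adj o hxc).resolve_left fun h => hcy ?_⟩
    refine eq_of_mem_ancestors_of_dist_eq hG (o := o) (x := x) ?_ ?_ (by omega)
    · rw [ancestors_of_adj hG o hxc.symm h]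
      exact Finset.mem_insert_of_mem (self_mem_ancestors hG o c)
    · rw [ancestors_of_adj hG o hxy.symm hd]
      exact Finset.mem_insert_of_mem (self_mem_ancestors hG o y)
  have hdisj : ((G.neighborFinset x).erase y : Set V).PairwiseDisjoint (subtree G o) := by
    intro c hc c' hc' hne
    refine Finset.disjoint_left.2 fun w hw hw' => hne ?_
    rw [mem_subtree_iff hG] at hw hw'
    exact eq_of_mem_ancestors_of_dist_eq hG hw hw' (by
      rw [(hchild c hc).2, (hchild c' hc').2])
  have hsub : ((G.neighborFinset x).erase y).biUnion (subtree G o) ⊆ (subtree G o x).erase x := by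
    intro w hw
    obtain ⟨c, hc, hcw⟩ := Finset.mem_biUnion.1 hw
    obtain ⟨hxc, hdc⟩ := hchild c hc
    rw [mem_subtree_iff hG] at hcw
    refine Finset.mem_erase.2 ⟨?_, (mem_subtree_iff hG).2 (ancestors_subset hG hcw ?_)⟩
    · rintro rfl
      exact not_mem_ancestors_of_adj hG o hdc hcw
    · rw [ancestors_of_adj hG o hxc hdc]
      exact Finset.mem_insert_of_mem (self_mem_ancestors hG o x)
  have hxx : x ∈ subtree G o x := (mem_subtree_iff hG).2 (self_mem_ancestors hG o x)
  have hcard := Finset.card_le_card hsub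
  rw [Finset.card_biUnion hdisj, Finset.card_erase_of_mem hxx] at hcard
  have hpos : 1 ≤ (subtree G o x).card := Finset.card_pos.2 ⟨x, hxx⟩
  have hcard' : ∑ c ∈ (G.neighborFinset x).erase y, ((subtree G o c).card : ℝ) + 1 ≤
      (subtree G o x).card := by
    exact_mod_cast (by omega : ∑ c ∈ (G.neighborFinset x).erase y, (subtree G o c).card + 1 ≤
      (subtree G o x).card)
  rw [← Finset.add_sum_erase _ _ hy, hittingSum_of_adj hG hxy.symm hd]
  rw [Finset.sum_congr rfl fun c hc => by
    rw [hittingSum_of_adj hG (hchild c hc).1 (hchild c hc).2, hittingSum_of_adj hG hxy.symm hd,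
      add_sub_cancel_left]]
  linarith

lemma commonAncestors_of_mem_subtree {v x : V} (hx : x ∈ subtree G o v) :
    commonAncestors hG (o := o) v x = G.dist o v + 1 := by
  rw [mem_subtree_iff hG] at hx
  rw [commonAncestors, Finset.inter_eq_right.2 (ancestors_subset hG hx), card_ancestors]
  push_cast
  rfl

/-- The Dirichlet energy of `commonAncestors v` is at most the length of the path to `v`. -/
lemma dirichlet_commonAncestors_le [DecidableRel G.Adj] (v : V) :
    (∑ x, ∑ y, if G.Adj x y then
      (commonAncestors hG (o := o) v x - commonAncestors hG (o := o) v y) ^ 2 else 0) / 2 ≤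
      (G.dist o v : ℝ) := by
  -- F marks the edges of the path to v, oriented away from the root. Each non-root ancestor of v
  -- has only one parent, so F sums to at most |v|; the halving undoes the count of both
  -- orientations.
  set F : V → V → ℝ := fun x y =>
    if G.Adj x y ∧ G.dist o y = G.dist o x + 1 ∧ y ∈ ancestors hG o v then 1 else 0 with hF
  have hterm : ∀ x y, (if G.Adj x y then
      (commonAncestors hG (o := o) v x - commonAncestors hG (o := o) v y) ^ 2 else 0) ≤
      F x y + F y x := by
    intro x y
    have hF0 : ∀ x y, 0 ≤ F x y := fun x y => by simp only [hF]; split_ifs <;> norm_num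
    split_ifs with hxy
    · rcases hG.dist_eq_dist_add_one_of_adj o hxy with hd | hd
      · have h1 : F y x = if x ∈ ancestors hG o v then 1 else 0 := by
          simp [hF, hxy.symm, hd]
        rw [commonAncestors_of_adj hG hxy.symm hd, h1]
        have := hF0 x y
        split_ifs <;> linarith
      · have h1 : F x y = if y ∈ ancestors hG o v then 1 else 0 := by
          simp [hF, hxy, hd]
        rw [← neg_sub, neg_sq, commonAncestors_of_adj hG hxy hd, h1]
        have := hF0 y x
        split_ifs <;> linarith
    · exact add_nonneg (hF0 x y) (hF0 y x)
  have hsum : ∑ y, ∑ x, F x y ≤ (G.dist o v : ℝ) := by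
    have hcol : ∀ y, ∑ x, F x y ≤ if y ∈ (ancestors hG o v).erase o then 1 else 0 := by
      intro y
      simp only [hF]
      rw [Finset.sum_boole]
      split_ifs with hy
      · rw [Nat.cast_le_one, Finset.card_le_one]
        simp only [Finset.mem_filter, Finset.mem_univ, true_and]
        rintro a ⟨ha, hda, -⟩ b ⟨hb, hdb, -⟩
        refine eq_of_mem_ancestors_of_dist_eq hG (o := o) (x := y) ?_ ?_ (by omega)
        · rw [ancestors_of_adj hG o ha hda]
          exact Finset.mem_insert_of_mem (self_mem_ancestors hG o a)
        · rw [ancestors_of_adj hG o hb hdb]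
          exact Finset.mem_insert_of_mem (self_mem_ancestors hG o b)
      · rw [Nat.cast_nonpos, Finset.card_eq_zero, Finset.filter_eq_empty_iff]
        rintro a - ⟨-, hda, hya⟩
        refine hy (Finset.mem_erase.2 ⟨?_, hya⟩)
        rintro rfl
        simp at hda
    refine (Finset.sum_le_sum fun y _ => hcol y).trans (le_of_eq ?_)
    rw [Finset.sum_boole, Finset.filter_mem_eq_inter, Finset.univ_inter,
      Finset.card_erase_of_mem (root_mem_ancestors hG o v), card_ancestors]
    simp
  have hle := Finset.sum_le_sum fun x (_ : x ∈ Finset.univ) =>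
    Finset.sum_le_sum fun y (_ : y ∈ Finset.univ) => hterm x y
  simp only [Finset.sum_add_distrib] at hle
  rw [Finset.sum_comm (f := fun x y => F x y)] at hle
  linarith

/-- If the root is a center of mass, then a fixed proportion of all vertices lies on the other side
of the root than `v`. -/
lemma IsCenterOfMass.exists_commonAncestors_eq_one {δ : ℝ} (ho : IsCenterOfMass G δ o) (v : V) :
    ∃ A : Finset V, δ * Fintype.card V ≤ A.card ∧
      ∀ x ∈ A, commonAncestors hG (o := o) v x = 1 := by
  obtain ⟨T, T', hT, hT', hint, hun, hc, hc'⟩ := ho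
  have hoT : o ∈ T.verts ∩ T'.verts := by rw [hint]; rfl
  -- Root paths stay inside T and T' respectively, so they share only o. The set A is then whichever
  -- of the two was not chosen to contain v.
  have key : ∀ x y, x ∈ T.verts → y ∈ T'.verts →
      ancestors hG o x ∩ ancestors hG o y = {o} := by
    intro x y hx hy
    ext u
    simp only [Finset.mem_inter, Finset.mem_singleton]
    constructor
    · rintro ⟨h1, h2⟩
      have : u ∈ T.verts ∩ T'.verts := ⟨ancestors_subset_verts hG hT hoT.1 hx u h1,
        ancestors_subset_verts hG hT' hoT.2 hy u h2⟩
      rw [hint] at this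
      exact this
    · rintro rfl
      exact ⟨root_mem_ancestors hG _ x, root_mem_ancestors hG _ y⟩
  rw [Nat.card_eq_fintype_card] at hc hc'
  have hv : v ∈ T.verts ∪ T'.verts := by rw [hun]; trivial
  rcases hv with hv | hv
  · refine ⟨T'.verts.toFinite.toFinset, ?_, fun x hx => ?_⟩
    · rwa [← Set.ncard_eq_toFinset_card]
    · rw [commonAncestors, Finset.inter_comm, key v x hv (by simpa using hx)]
      simp
  · refine ⟨T.verts.toFinite.toFinset, ?_, fun x hx => ?_⟩
    · rwa [← Set.ncard_eq_toFinset_card]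
    · rw [commonAncestors, key x v (by simpa using hx) hv]
      simp

end Ancestors

/-! ### Total variation, contraction, and eigenvectors as obstructions to mixing. -/

section Mixing

variable {V : Type*} [Fintype V]

lemma tvDist_le_iff {μ ν : V → ℝ} {ε : ℝ} :
    tvDist μ ν ≤ ε ↔ ∀ A : Finset V, |∑ y ∈ A, μ y - ∑ y ∈ A, ν y| ≤ ε := by
  simp [tvDist, Finset.sup'_le_iff]

lemma sum_abs_sub_le_of_tvDist_le {μ ν : V → ℝ} {ε : ℝ} (h : tvDist μ ν ≤ ε) :
    ∑ y, |μ y - ν y| ≤ 2 * ε := by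
  rw [tvDist_le_iff] at h
  have h1 := h (Finset.univ.filter fun y => ν y ≤ μ y)
  have h2 := h (Finset.univ.filter fun y => ¬ ν y ≤ μ y)
  rw [← Finset.sum_sub_distrib] at h1 h2
  rw [← Finset.sum_filter_add_sum_filter_not Finset.univ (fun y => ν y ≤ μ y)]
  have e1 : ∑ y with ν y ≤ μ y, |μ y - ν y| = ∑ y with ν y ≤ μ y, (μ y - ν y) :=
    Finset.sum_congr rfl fun y hy =>
      abs_of_nonneg (sub_nonneg.2 (Finset.mem_filter.1 hy).2)
  have e2 : ∑ y with ¬ ν y ≤ μ y, |μ y - ν y| = -∑ y with ¬ ν y ≤ μ y, (μ y - ν y) := by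
    rw [← Finset.sum_neg_distrib]
    exact Finset.sum_congr rfl fun y hy =>
      abs_of_neg (sub_neg.2 (not_le.1 (Finset.mem_filter.1 hy).2))
  rw [e1, e2]
  linarith [le_abs_self (∑ y with ν y ≤ μ y, (μ y - ν y)),
    neg_le_abs (∑ y with ¬ ν y ≤ μ y, (μ y - ν y))]

variable [DecidableEq V] (G : SimpleGraph V) [DecidableRel G.Adj]

/-- Under a minorization of the semigroup, functions of mean zero contract. -/
lemma abs_heat_mulVec_le [Nonempty V] {t : ℝ}
    (hmin : ∀ x y, (4 * (Fintype.card V : ℝ))⁻¹ ≤ heat G t x y) {f : V → ℝ} {B : ℝ}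
    (hf : ∑ x, f x = 0) (hB : ∀ x, |f x| ≤ B) (x : V) :
    |(heat G t *ᵥ f) x| ≤ 3 / 4 * B := by
  have hN : (0 : ℝ) < Fintype.card V := by exact_mod_cast Fintype.card_pos
  -- Since f has mean zero, 1/(4N) can be subtracted from the kernel; what remains is nonnegative
  -- with row sums 3/4.
  have h1 : (heat G t *ᵥ f) x = ∑ y, (heat G t x y - (4 * (Fintype.card V : ℝ))⁻¹) * f y := by
    simp only [mulVec, dotProduct, sub_mul, Finset.sum_sub_distrib, ← Finset.mul_sum, hf]
    ring
  rw [h1]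
  calc |∑ y, (heat G t x y - (4 * (Fintype.card V : ℝ))⁻¹) * f y|
      ≤ ∑ y, |(heat G t x y - (4 * (Fintype.card V : ℝ))⁻¹) * f y| :=
        Finset.abs_sum_le_sum_abs _ _
    _ ≤ ∑ y, (heat G t x y - (4 * (Fintype.card V : ℝ))⁻¹) * B := by
        refine Finset.sum_le_sum fun y _ => ?_
        rw [abs_mul, abs_of_nonneg (sub_nonneg.2 (hmin x y))]
        exact mul_le_mul_of_nonneg_left (hB y) (sub_nonneg.2 (hmin x y))
    _ = 3 / 4 * B := by
        rw [← Finset.sum_mul, Finset.sum_sub_distrib, sum_heat, Finset.sum_const,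
          Finset.card_univ, nsmul_eq_mul]
        field_simp
        ring

lemma abs_heat_nsmul_mulVec_le [Nonempty V] {t : ℝ}
    (hmin : ∀ x y, (4 * (Fintype.card V : ℝ))⁻¹ ≤ heat G t x y) {f : V → ℝ}
    (hf : ∑ x, f x = 0) (hB : ∀ x, |f x| ≤ 1) (k : ℕ) (x : V) :
    |(heat G (k * t) *ᵥ f) x| ≤ (3 / 4) ^ k := by
  induction k generalizing x with
  | zero => simpa [heat_zero] using hB x
  | succ k ih =>
    rw [show ((k + 1 : ℕ) : ℝ) * t = t + k * t by push_cast; ring, heat_add, ← mulVec_mulVec,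
      pow_succ']
    exact abs_heat_mulVec_le G hmin (by rw [sum_heat_mulVec, hf]) ih x

/-- Geometric convergence to the uniform distribution under a minorization. -/
lemma tvDist_transition_le [Nonempty V] {t : ℝ}
    (hmin : ∀ x y, (4 * (Fintype.card V : ℝ))⁻¹ ≤ heat G t x y) (k : ℕ) (x : V) :
    tvDist (transition G (k * t) x) (uniform V) ≤ (3 / 4) ^ k := by
  have hN : (0 : ℝ) < Fintype.card V := by exact_mod_cast Fintype.card_pos
  refine tvDist_le_iff.2 fun A => ?_
  set a : ℝ := A.card / Fintype.card V with ha
  have ha0 : 0 ≤ a := by positivity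
  have ha1 : a ≤ 1 := (div_le_one hN).2 (by exact_mod_cast Finset.card_le_univ A)
  -- The centered indicator of A: the semigroup maps it to the discrepancy between the law of the
  -- walk and the uniform law on A.
  set f : V → ℝ := fun y => (if y ∈ A then 1 else 0) - a with hfdef
  have hf : ∑ y, f y = 0 := by
    simp only [hfdef, Finset.sum_sub_distrib, Finset.sum_ite_mem, Finset.univ_inter,
      Finset.sum_const, Finset.card_univ, nsmul_eq_mul, mul_one, ha]
    field_simp
    ring
  have hB : ∀ y, |f y| ≤ 1 := by
    intro y
    simp only [hfdef]
    split_ifs <;> rw [abs_le] <;> constructor <;> linarith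
  have h := abs_heat_nsmul_mulVec_le G hmin hf hB k x
  convert h using 2
  simp only [mulVec, dotProduct, hfdef, mul_sub, Finset.sum_sub_distrib, ← Finset.sum_mul,
    sum_heat, mul_ite, mul_one, mul_zero, Finset.sum_ite_mem, Finset.univ_inter, one_mul]
  simp [transition, heat, uniform, ha, div_eq_mul_inv]

lemma mixingTime_le [Nonempty V] {t : ℝ} (ht : 0 ≤ t)
    (hmin : ∀ x y, (4 * (Fintype.card V : ℝ))⁻¹ ≤ heat G t x y) {ε : ℝ} (hε : 3 / 4 ≤ ε) :
    mixingTime G ε ≤ t := by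
  refine csInf_le ⟨0, fun s hs => hs.1⟩ ⟨ht, fun x => ?_⟩
  have h := tvDist_transition_le G hmin 1 x
  simp only [Nat.cast_one, one_mul, pow_one] at h
  exact h.trans hε

/-- Needed for lower bounds on the mixing time, since `sInf` of an empty set of reals is 0. -/
lemma mixingTimes_nonempty [Nonempty V] {t : ℝ} (ht : 0 ≤ t)
    (hmin : ∀ x y, (4 * (Fintype.card V : ℝ))⁻¹ ≤ heat G t x y) {ε : ℝ} (hε : 0 < ε) :
    {t : ℝ | 0 ≤ t ∧ ∀ x : V, tvDist (transition G t x) (uniform V) ≤ ε}.Nonempty := by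
  obtain ⟨k, hk⟩ := exists_pow_lt_of_lt_one hε (by norm_num : (3 / 4 : ℝ) < 1)
  exact ⟨k * t, by positivity, fun x => (tvDist_transition_le G hmin k x).trans hk.le⟩

/-- An eigenvector of mean zero bounds the distance to stationarity from below. -/
lemma exp_le_of_tvDist_le {φ : V → ℝ} {lam : ℝ} (hφ : φ ≠ 0) (hsum : ∑ x, φ x = 0)
    (heig : generator G *ᵥ φ = (-lam) • φ) {t ε : ℝ}
    (h : ∀ x, tvDist (transition G t x) (uniform V) ≤ ε) : Real.exp (-lam * t) ≤ 2 * ε := by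
  obtain ⟨x₀, hx₀⟩ : ∃ x, φ x ≠ 0 := Function.ne_iff.1 hφ
  obtain ⟨x, -, hx⟩ := Finset.exists_max_image Finset.univ (fun x => |φ x|) ⟨x₀, Finset.mem_univ _⟩
  have hpos : 0 < |φ x| := (abs_pos.2 hx₀).trans_le (hx x₀ (Finset.mem_univ _))
  have h1 := congrFun (heat_mulVec_of_eigenvector G heig t) x
  have h2 : (heat G t *ᵥ φ) x = ∑ y, (transition G t x y - uniform V y) * φ y := by
    simp only [sub_mul, Finset.sum_sub_distrib, uniform, ← Finset.mul_sum, hsum, mul_zero, sub_zero]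
    rfl
  have h3 : |(heat G t *ᵥ φ) x| ≤ 2 * ε * |φ x| := by
    rw [h2]
    calc |∑ y, (transition G t x y - uniform V y) * φ y|
        ≤ ∑ y, |(transition G t x y - uniform V y) * φ y| := Finset.abs_sum_le_sum_abs _ _
      _ ≤ ∑ y, |transition G t x y - uniform V y| * |φ x| := by
          refine Finset.sum_le_sum fun y _ => ?_
          rw [abs_mul]
          exact mul_le_mul_of_nonneg_left (hx y (Finset.mem_univ _)) (abs_nonneg _)
      _ ≤ 2 * ε * |φ x| := by
          rw [← Finset.sum_mul]
          exact mul_le_mul_of_nonneg_right (sum_abs_sub_le_of_tvDist_le (h x)) hpos.le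
  rw [h1, Pi.smul_apply, smul_eq_mul, abs_mul, Real.abs_exp] at h3
  exact le_of_mul_le_mul_right h3 hpos

/-- Variational bound: a nonzero function of mean zero and Dirichlet energy at most `κ ‖f‖²` yields
an eigenvector of mean zero with eigenvalue at most `κ`. -/
lemma exists_eigenvector_of_rayleigh_le (hconn : G.Connected) {f : V → ℝ} {κ : ℝ} (hf0 : f ≠ 0)
    (hsum : ∑ x, f x = 0) (hκ : f ⬝ᵥ (G.lapMatrix ℝ *ᵥ f) ≤ κ * (f ⬝ᵥ f)) :
    ∃ (φ : V → ℝ) (lam : ℝ), φ ≠ 0 ∧ ∑ x, φ x = 0 ∧ lam ≤ κ ∧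
      generator G *ᵥ φ = (-lam) • φ := by
  have hA : (G.lapMatrix ℝ).IsHermitian := G.isHermitian_lapMatrix ℝ
  set b := hA.eigenvectorBasis with hb
  have heig : ∀ i, G.lapMatrix ℝ *ᵥ ⇑(b i) = hA.eigenvalues i • ⇑(b i) :=
    hA.mulVec_eigenvectorBasis
  have hsymm : ∀ u w : V → ℝ, u ⬝ᵥ (G.lapMatrix ℝ *ᵥ w) = (G.lapMatrix ℝ *ᵥ u) ⬝ᵥ w := by
    intro u w
    rw [dotProduct_mulVec, ← mulVec_transpose, (G.isSymm_lapMatrix ℝ).eq]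
  have hexpand : ∀ u w : V → ℝ, u ⬝ᵥ w = ∑ i, (u ⬝ᵥ ⇑(b i)) * (⇑(b i) ⬝ᵥ w) := by
    intro u w
    have := b.sum_inner_mul_inner (WithLp.toLp 2 u) (WithLp.toLp 2 w)
    simp only [EuclideanSpace.inner_eq_star_dotProduct, star_trivial] at this
    rw [dotProduct_comm, ← this]
    exact Finset.sum_congr rfl fun i _ => by
      rw [dotProduct_comm u, dotProduct_comm _ w]
  -- An eigenvector with nonzero eigenvalue is orthogonal to constants; one with eigenvalue 0 is
  -- constant by connectedness, hence orthogonal to f.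
  have hzero : ∀ i, ⇑(b i) ⬝ᵥ f ≠ 0 → ∑ x, (b i) x = 0 := by
    intro i hi
    have h1 : hA.eigenvalues i * ∑ x, (b i) x = 0 := by
      have h := hsymm 1 ⇑(b i)
      have h0 : G.lapMatrix ℝ *ᵥ (1 : V → ℝ) = 0 := G.lapMatrix_mulVec_const_eq_zero
      rw [heig, h0, dotProduct_smul, zero_dotProduct, one_dotProduct] at h
      exact h
    refine (mul_eq_zero.1 h1).resolve_left fun hl => hi ?_
    have h2 : G.lapMatrix ℝ *ᵥ ⇑(b i) = 0 := by rw [heig, hl, zero_smul]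
    have h3 := (G.lapMatrix_mulVec_eq_zero_iff_forall_reachable).1 h2
    obtain ⟨x₀⟩ := hconn.nonempty
    have h4 : ∀ x, (b i) x = (b i) x₀ := fun x => h3 x x₀ (hconn x x₀)
    simp only [dotProduct, h4, ← Finset.mul_sum, hsum, mul_zero]
  have hex : ∃ i, ⇑(b i) ⬝ᵥ f ≠ 0 ∧ hA.eigenvalues i ≤ κ := by
    by_contra hno
    push Not at hno
    have hle : f ⬝ᵥ (G.lapMatrix ℝ *ᵥ f) = ∑ i, hA.eigenvalues i * (⇑(b i) ⬝ᵥ f) ^ 2 := by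
      rw [hexpand]
      refine Finset.sum_congr rfl fun i _ => ?_
      rw [hsymm, heig, smul_dotProduct, dotProduct_comm f, smul_eq_mul]
      ring
    have hff : f ⬝ᵥ f = ∑ i, (⇑(b i) ⬝ᵥ f) ^ 2 := by
      rw [hexpand]
      exact Finset.sum_congr rfl fun i _ => by rw [dotProduct_comm f, sq]
    have hpos : 0 < f ⬝ᵥ f := by
      obtain ⟨x, hx⟩ := Function.ne_iff.1 hf0
      exact Finset.sum_pos' (fun y _ => mul_self_nonneg _)
        ⟨x, Finset.mem_univ _, mul_self_pos.2 hx⟩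
    obtain ⟨i, -, hi⟩ : ∃ i ∈ Finset.univ, (⇑(b i) ⬝ᵥ f) ^ 2 ≠ 0 := by
      rw [hff] at hpos
      exact Finset.exists_ne_zero_of_sum_ne_zero hpos.ne'
    have hlt : κ * (f ⬝ᵥ f) < f ⬝ᵥ (G.lapMatrix ℝ *ᵥ f) := by
      rw [hle, hff, Finset.mul_sum]
      refine Finset.sum_lt_sum (fun j _ => ?_) ⟨i, Finset.mem_univ _, ?_⟩
      · by_cases hj : ⇑(b j) ⬝ᵥ f = 0
        · simp [hj]
        · exact mul_le_mul_of_nonneg_right (hno j hj).le (sq_nonneg _)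
      · exact mul_lt_mul_of_pos_right (hno i fun h => hi (by rw [h]; simp)) (by positivity)
    linarith
  obtain ⟨i, hi, hle⟩ := hex
  refine ⟨⇑(b i), hA.eigenvalues i, fun h => hi (by rw [h, zero_dotProduct]), hzero i hi, hle, ?_⟩
  rw [generator_eq_neg_lapMatrix, neg_mulVec, heig, neg_smul]

end Mixing

/-! ### Bounds on the spectral gap and mixing time of a tree. -/

section Tree

variable {V : Type*} [Fintype V] [DecidableEq V] [Nontrivial V] {G : SimpleGraph V} {o : V}

lemma maxPathWeight_pos (hG : G.IsTree) : 0 < maxPathWeight G o := by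
  obtain ⟨w, hw⟩ := exists_ne o
  have h1 := hittingSum_le hG (o := o) w
  have h2 : 0 < hittingSum hG (o := o) w := Finset.sum_pos
    (fun u _ => Nat.cast_pos.2 (Finset.card_pos.2
      ⟨u, (mem_subtree_iff hG).2 (self_mem_ancestors hG o u)⟩))
    ⟨w, Finset.mem_erase.2 ⟨hw, self_mem_ancestors hG o w⟩⟩
  exact_mod_cast h2.trans_le h1

variable [DecidableRel G.Adj]

/-- The maximal edge weight is attained at the edge below some vertex other than the root. -/
lemma exists_maxEdgeWeight_eq (hG : G.IsTree) :
    ∃ v, 0 < G.dist o v ∧ 0 < (subtree G o v).card ∧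
      maxEdgeWeight G o = G.dist o v * (subtree G o v).card := by
  classical
  obtain ⟨w, hw⟩ := exists_ne o
  obtain ⟨y, hwy, -⟩ := exists_parent hG hw
  have hne : G.edgeFinset.Nonempty := ⟨s(w, y), by simpa using hwy⟩
  obtain ⟨e, he, hmax⟩ := Finset.exists_mem_eq_sup G.edgeFinset hne
    (fun e => edgeHeight G o e * edgeSubtreeSize G o e)
  refine ⟨upperEnd G o e, ?_, ?_, ?_⟩
  · induction e with
    | _ a b =>
      have hab : G.Adj a b := by simpa using he
      rcases hG.dist_eq_dist_add_one_of_adj o hab with hd | hd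
      · rw [Sym2.eq_swap, upperEnd_of_dist_lt (by omega)]
        omega
      · rw [upperEnd_of_dist_lt (by omega)]
        omega
  · exact Finset.card_pos.2 ⟨_, (mem_subtree_iff hG).2 (self_mem_ancestors hG o _)⟩
  · refine Eq.trans ?_ hmax
    unfold maxEdgeWeight
    congr!

/-- The spectral gap is at most of the order of the inverse of the maximal edge weight. -/
lemma exists_eigenvector_le_inv_maxEdgeWeight (hG : G.IsTree) {δ : ℝ} (hδ : 0 < δ)
    (ho : IsCenterOfMass G δ o) :
    ∃ (φ : V → ℝ) (lam : ℝ), φ ≠ 0 ∧ ∑ x, φ x = 0 ∧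
      lam ≤ (1 + δ) / δ / maxEdgeWeight G o ∧ generator G *ᵥ φ = (-lam) • φ := by
  obtain ⟨v, hv, hcard, hm⟩ := exists_maxEdgeWeight_eq (o := o) hG
  obtain ⟨A, hA, hA1⟩ := ho.exists_commonAncestors_eq_one hG v
  have hN : (0 : ℝ) < Fintype.card V := by exact_mod_cast Fintype.card_pos
  set F := commonAncestors hG (o := o) v with hF
  set m : ℝ := (∑ x, F x) / Fintype.card V with hmean
  set h : ℝ := (G.dist o v : ℝ) with hh
  set a : ℝ := ((subtree G o v).card : ℝ) with haa
  have hhpos : 0 < h := Nat.cast_pos.2 hv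
  have hapos : 0 < a := Nat.cast_pos.2 hcard
  have haN : a ≤ Fintype.card V := Nat.cast_le.2 (Finset.card_le_univ _)
  set f : V → ℝ := fun x => F x - m with hf
  have hsum : ∑ x, f x = 0 := by
    simp only [hf, Finset.sum_sub_distrib, Finset.sum_const, Finset.card_univ, nsmul_eq_mul, hmean]
    field_simp
    ring
  have hdisj : Disjoint (subtree G o v) A := by
    refine Finset.disjoint_left.2 fun x hx hx' => ?_
    have h1 : F x = h + 1 := commonAncestors_of_mem_subtree hG hx
    rw [hA1 x hx'] at h1
    linarith
  have hnorm : a * (h + 1 - m) ^ 2 + A.card * (1 - m) ^ 2 ≤ f ⬝ᵥ f := by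
    have h1 : ∑ x ∈ subtree G o v, f x * f x = a * (h + 1 - m) ^ 2 := by
      rw [Finset.sum_congr rfl fun x hx => by
        rw [show f x = h + 1 - m by
          simp only [hf, hF, commonAncestors_of_mem_subtree hG hx, hh]], Finset.sum_const,
        nsmul_eq_mul]
      ring
    have h2 : ∑ x ∈ A, f x * f x = A.card * (1 - m) ^ 2 := by
      rw [Finset.sum_congr rfl fun x hx => by
        rw [show f x = 1 - m by simp only [hf, hA1 x hx]], Finset.sum_const, nsmul_eq_mul]
      ring
    rw [← h1, ← h2, ← Finset.sum_union hdisj]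
    exact Finset.sum_le_univ_sum_of_nonneg fun x => mul_self_nonneg _
  have hlow : δ / (1 + δ) * a * h ^ 2 ≤ f ⬝ᵥ f := by
    refine le_trans ?_ hnorm
    have hAa : δ * a ≤ A.card := (mul_le_mul_of_nonneg_left haN hδ.le).trans hA
    have h3 : δ * a * (1 - m) ^ 2 ≤ A.card * (1 - m) ^ 2 :=
      mul_le_mul_of_nonneg_right hAa (sq_nonneg _)
    refine le_trans ?_ (add_le_add_right h3 _)
    -- With p = h+1-m and q = 1-m, so p - q = h, the difference of the two sides is (p + δq)²; the
    -- unknown mean m drops out.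
    have h4 : δ * h ^ 2 ≤ (1 + δ) * ((h + 1 - m) ^ 2 + δ * (1 - m) ^ 2) := by
      nlinarith [sq_nonneg ((h + 1 - m) + δ * (1 - m))]
    have h5 : δ / (1 + δ) * a * h ^ 2 = a / (1 + δ) * (δ * h ^ 2) := by ring
    rw [h5]
    refine (mul_le_mul_of_nonneg_left h4 (by positivity)).trans (le_of_eq ?_)
    field_simp
  have hpos : 0 < f ⬝ᵥ f := lt_of_lt_of_le (by positivity) hlow
  have hen : f ⬝ᵥ (G.lapMatrix ℝ *ᵥ f) ≤ h := by
    rw [← toLinearMap₂'_apply', SimpleGraph.lapMatrix_toLinearMap₂']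
    simp only [hf, sub_sub_sub_cancel_right]
    exact dirichlet_commonAncestors_le hG v
  refine exists_eigenvector_of_rayleigh_le G hG.connected (f := f) ?_ hsum ?_
  · intro h0
    simp [h0] at hpos
  · refine hen.trans ?_
    have hm' : (maxEdgeWeight G o : ℝ) = h * a := by rw [hm]; push_cast; rfl
    rw [hm']
    refine le_trans (le_of_eq ?_) (mul_le_mul_of_nonneg_left hlow (by positivity))
    field_simp

lemma heat_minorization_of_isTree (hG : G.IsTree) (x y : V) :
    (4 * (Fintype.card V : ℝ))⁻¹ ≤ heat G (4 * maxPathWeight G o * Real.log 4) x y :=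
  heat_minorization G (o := o) (Nat.cast_pos.2 (maxPathWeight_pos hG)) (hittingSum_nonneg hG)
    (hittingSum_le hG) (fun _ hx => generator_hittingSum_le hG hx) x y

/-- Mixing to a constant distance takes at most the order of the maximal path weight. -/
lemma mixingTime_le_maxPathWeight (hG : G.IsTree) {ε : ℝ} (hε : 3 / 4 ≤ ε) :
    mixingTime G ε ≤ 4 * maxPathWeight G o * Real.log 4 :=
  mixingTime_le G (mul_nonneg (by positivity) (Real.log_nonneg (by norm_num)))
    (heat_minorization_of_isTree hG) hε

/-- Mixing to a small distance takes at least the order of the maximal edge weight. -/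
lemma le_mixingTime (hG : G.IsTree) {δ : ℝ} (hδ : 0 < δ) (ho : IsCenterOfMass G δ o) {ε : ℝ}
    (hε : 0 < ε) (c : ℝ) (hc : 2 * ε < Real.exp (-((1 + δ) / δ * c))) :
    c * maxEdgeWeight G o ≤ mixingTime G ε := by
  obtain ⟨φ, lam, hφ, hsum, hlam, heig⟩ := exists_eigenvector_le_inv_maxEdgeWeight hG hδ ho
  obtain ⟨v, hv, hcard, hm⟩ := exists_maxEdgeWeight_eq (o := o) hG
  have hmpos : (0 : ℝ) < maxEdgeWeight G o := by
    rw [hm]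
    exact_mod_cast Nat.mul_pos hv hcard
  refine le_csInf (mixingTimes_nonempty G (mul_nonneg (by positivity) (Real.log_nonneg
    (by norm_num))) (heat_minorization_of_isTree (o := o) hG) hε) fun t ht => ?_
  by_contra hlt
  push Not at hlt
  have h1 := exp_le_of_tvDist_le G hφ hsum heig ht.2
  have h2 : lam * t ≤ (1 + δ) / δ * c := by
    calc lam * t ≤ (1 + δ) / δ / maxEdgeWeight G o * t := mul_le_mul_of_nonneg_right hlam ht.1
      _ ≤ (1 + δ) / δ / maxEdgeWeight G o * (c * maxEdgeWeight G o) :=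
        mul_le_mul_of_nonneg_left hlt.le (by positivity)
      _ = (1 + δ) / δ * c := by field_simp
  have h3 : Real.exp (-((1 + δ) / δ * c)) ≤ Real.exp (-lam * t) :=
    Real.exp_le_exp.2 (by linarith)
  linarith

end Tree

end TreeWalk

theorem theorem1p3 {V : ℕ → Type*} [∀ n, Fintype (V n)] [∀ n, DecidableEq (V n)]
    [∀ n, Nontrivial (V n)]
    (G : ∀ n, SimpleGraph (V n)) [∀ n, DecidableRel (G n).Adj]
    (hG : ∀ n, (G n).IsTree)
    (o : ∀ n, V n) (δ : ℝ) (hδ : 0 < δ)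
    (ho : ∀ n, TreeWalk.IsCenterOfMass (G n) δ (o n))
    (h : (fun n => (TreeWalk.maxEdgeWeight (G n) (o n) : ℝ)) =Θ[Filter.atTop]
      (fun n => (TreeWalk.maxPathWeight (G n) (o n) : ℝ))) :
    ¬ TreeWalk.ExhibitsCutoff G := by
  intro hcut
  obtain ⟨K, hK, hbound⟩ := h.2.exists_pos
  rw [Asymptotics.isBigOWith_iff] at hbound
  have hlog : 0 < Real.log 4 := Real.log_pos (by norm_num)
  -- With M ≤ Km, the lower bound cm is at least 8 M log 4, twice the upper bound 4 M log 4.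
  set c : ℝ := 8 * K * Real.log 4 with hc
  set E : ℝ := Real.exp (-((1 + δ) / δ * c)) with hE
  have hEpos : 0 < E := Real.exp_pos _
  have hE1 : E ≤ 1 := Real.exp_le_one_iff.2 (by
    have : 0 ≤ (1 + δ) / δ * c := by positivity
    linarith)
  -- The choice ε = E/4 gives 2ε < E for the lower bound and, as E ≤ 1, 1 - ε ≥ 3/4 for the upper
  -- bound.
  have hlim := hcut (E / 4) (by positivity) (by linarith)
  have hle : ∀ᶠ n in Filter.atTop,
      TreeWalk.mixingTime (G n) (1 - E / 4) / TreeWalk.mixingTime (G n) (E / 4) ≤ 1 / 2 := by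
    filter_upwards [hbound] with n hn
    rw [Real.norm_natCast, Real.norm_natCast] at hn
    have hup := TreeWalk.mixingTime_le_maxPathWeight (o := o n) (hG n)
      (ε := 1 - E / 4) (by linarith)
    have hlow := TreeWalk.le_mixingTime (hG n) hδ (ho n) (ε := E / 4) (by positivity) c
      (by rw [← hE]; linarith)
    have hMpos : (0 : ℝ) < TreeWalk.maxPathWeight (G n) (o n) :=
      Nat.cast_pos.2 (TreeWalk.maxPathWeight_pos (hG n))
    have h1 : 8 * Real.log 4 * TreeWalk.maxPathWeight (G n) (o n) ≤
        TreeWalk.mixingTime (G n) (E / 4) := by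
      refine le_trans ?_ hlow
      have := mul_le_mul_of_nonneg_left hn (by positivity : 0 ≤ 8 * Real.log 4)
      rw [hc]
      linarith
    have h2 : 0 < 8 * Real.log 4 * (TreeWalk.maxPathWeight (G n) (o n) : ℝ) := by positivity
    rw [div_le_iff₀ (h2.trans_le h1)]
    linarith
  have := le_of_tendsto hlim hle
  norm_num at this
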